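/- Let $X$ be a standard Borel space with a probability measure $\mu$, and let $\rho$ be a measurable, $\mu$-preserving, (essentially) free action of a countable discrete group $\Gamma$ on $X$, i.e. for every $g\neq 1$ one has $gx\neq x$ for $\mu$-almost every $x$. Let $R_\rho=\{(x,gx)\colon x\in X,\ g\in\Gamma\}\subset X\times X$ be the orbit equivalence relation, with the measure $m(C)=\int_X \#\{y\colon (x,y)\in C\}\,d\mu(x)$. A local isomorphism from $R_\rho$ is a Borel isomorphism $\varphi\colon A\to B$ between Borel subsets of $X$ whose graph is contained in $R_\rho$. Let $f\in L^\infty(X)=L^\infty(X,\mu;\mathbb C)$ and $\varphi$ act on $L^2(R_\rho,m)$ by $(f\xi)(x,y)=f(x)\xi(x,y)$ and $(\varphi\xi)(x,y)=1_{B}(x)\,\xi(\varphi^{-1}x,y)$. The relation ring $R_\rho(X)$ is the algebra of all operators $\sum_{i=1}^n f_i\varphi_i$ with $f_i\in L^\infty(X)$ and $\varphi_i$ local isomorphisms from $R_\rho$. Let $L^\infty(X)\rtimes_{\rm alg}\Gamma$ be the algebraic crossed product, consisting of the finite sums $\sum_g f_g\,g$ with $g f=f(g^{-1}\,\cdot\,)\,g$,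 and let $\iota\colon L^\infty(X)\rtimes_{\rm alg}\Gamma\to R_\rho(X)$ be the natural ring homomorphism, which is the identity on $L^\infty(X)$ and sends $g\in\Gamma$ to the local isomorphism $x\mapsto gx$. For an $L^\infty(X)$-bimodule $L$ and $\xi\in L$ put $$[\xi]=\inf\Big\{\int p\,d\mu+\int q\,d\mu\colon\ p,q\in L^\infty(X)\text{ projections},\ (1-p)\,\xi\,(1-q)=0\Big\},$$ and let the rank completion $c(L)$ be the bimodule of sequences in $L$ that are Cauchy for $d(\xi,\eta)=[\xi-\eta]$, modulo those that converge to $0$; a bimodule map $\phi\colon L\to L'$ induces $c(\phi)\colon c(L)\to c(L')$ termwise. Regard $L^\infty(X)\rtimes_{\rm alg}\Gamma$ and $R_\rho(X)$ as $L^\infty(X)$-bimodules with respect to the diagonal left action, $a\cdot\xi\cdot b=(ab)\xi$ (left multiplication). Then $\iota$ is injective, and the induced map $$c(\iota)\colon c\big(L^\infty(X)\rtimes_{\rm alg}\Gamma\big)\longrightarrow c\big(R_\rho(X)\big)$$ is an isomorphism of $L^\infty(X)$-bimodules. -/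

import Mathlib

namespace RankCompletion

open MeasureTheory Set Filter Topology
open scoped ENNReal TensorProduct

set_option linter.unusedSectionVars false

noncomputable section

section Linfty

/-- `L^∞(X, μ)`, the complex-valued essentially bounded functions modulo null sets. -/
abbrev Linfty {X : Type*} [MeasurableSpace X] (μ : Measure X) : Type _ := Lp ℂ ∞ μ

variable {X : Type*} [MeasurableSpace X] {μ : Measure X}

instance : Mul (Linfty μ) := ⟨fun f g => (f • g : Lp ℂ ∞ μ)⟩

theorem Linfty.coeFn_mul (f g : Linfty μ) : ⇑(f * g) =ᵐ[μ] fun x => f x * g x :=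
  Lp.coeFn_lpSMul f g

variable [IsFiniteMeasure μ]

instance : One (Linfty μ) := ⟨(memLp_const (1 : ℂ)).toLp (fun _ => (1 : ℂ))⟩

theorem Linfty.coeFn_one : ⇑(1 : Linfty μ) =ᵐ[μ] fun _ => (1 : ℂ) :=
  MemLp.coeFn_toLp _

/-- Pointwise multiplication makes `L^∞(X, μ)` a commutative ring. -/
instance : CommRing (Linfty μ) :=
  { (inferInstance : AddCommGroup (Lp ℂ ∞ μ)), (inferInstance : Mul (Linfty μ)),
    (inferInstance : One (Linfty μ)) with
    left_distrib := fun f g h => Lp.add_smul f g h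
    right_distrib := fun f g h => Lp.smul_add f g h
    zero_mul := fun f => Lp.zero_smul ℂ ∞ f
    mul_zero := fun f => Lp.smul_zero ℂ ∞ f
    mul_assoc := fun f g h => by
      apply Lp.ext
      filter_upwards [Linfty.coeFn_mul (f * g) h, Linfty.coeFn_mul f g,
        Linfty.coeFn_mul f (g * h), Linfty.coeFn_mul g h] with x h1 h2 h3 h4
      rw [h1, h2, h3, h4, mul_assoc]
    one_mul := fun f => by
      apply Lp.ext
      filter_upwards [Linfty.coeFn_mul 1 f, Linfty.coeFn_one (μ := μ)] with x h1 h2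
      rw [h1, h2, one_mul]
    mul_one := fun f => by
      apply Lp.ext
      filter_upwards [Linfty.coeFn_mul f 1, Linfty.coeFn_one (μ := μ)] with x h1 h2
      rw [h1, h2, mul_one]
    mul_comm := fun f g => by
      apply Lp.ext
      filter_upwards [Linfty.coeFn_mul f g, Linfty.coeFn_mul g f] with x h1 h2
      rw [h1, h2, mul_comm] }

instance : Algebra ℂ (Linfty μ) :=
  Algebra.ofModule (fun c f g => Lp.smul_assoc c f g) (fun c f g => by
    apply Lp.ext
    filter_upwards [Linfty.coeFn_mul f (c • g), Linfty.coeFn_mul f g, Lp.coeFn_smul c g,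
      Lp.coeFn_smul c (f * g)] with x h1 h2 h3 h4
    rw [h1, h3, h4, Pi.smul_apply, Pi.smul_apply, h2, smul_eq_mul, smul_eq_mul]
    ring)

variable {Γ : Type*} [Group Γ] [MulAction Γ X] [MeasurableConstSMul Γ X]
  [SMulInvariantMeasure Γ X μ]

/-- The action of `Γ` on `L^∞(X, μ)` by `(g • f)(x) = f (g⁻¹ • x)`. -/
instance : SMul Γ (Linfty μ) := ⟨fun g f => DomMulAct.mk g⁻¹ • f⟩

theorem Linfty.coeFn_group_smul (g : Γ) (f : Linfty μ) :
    ⇑(g • f) =ᵐ[μ] fun x => f (g⁻¹ • x) :=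
  DomMulAct.smul_Lp_ae_eq (DomMulAct.mk g⁻¹) f

theorem ae_smul {P : X → Prop} (g : Γ) (h : ∀ᵐ x ∂μ, P x) : ∀ᵐ x ∂μ, P (g • x) :=
  (measurePreserving_smul g μ).quasiMeasurePreserving.ae h

instance : MulSemiringAction Γ (Linfty μ) where
  one_smul f := by
    apply Lp.ext
    filter_upwards [Linfty.coeFn_group_smul (1 : Γ) f] with x h
    rw [h, inv_one, one_smul]
  mul_smul g h f := by
    apply Lp.ext
    filter_upwards [Linfty.coeFn_group_smul (g * h) f, Linfty.coeFn_group_smul g (h • f),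
      ae_smul g⁻¹ (Linfty.coeFn_group_smul h f)] with x h1 h2 h3
    rw [h1, h2, h3, mul_inv_rev, mul_smul]
  smul_zero g := smul_zero (DomMulAct.mk g⁻¹)
  smul_add g f f' := smul_add (DomMulAct.mk g⁻¹) f f'
  smul_one g := by
    apply Lp.ext
    filter_upwards [Linfty.coeFn_group_smul g (1 : Linfty μ), Linfty.coeFn_one (μ := μ),
      ae_smul g⁻¹ (Linfty.coeFn_one (μ := μ))] with x h1 h2 h3
    rw [h1, h2, h3]
  smul_mul g f f' := by
    apply Lp.ext
    filter_upwards [Linfty.coeFn_group_smul g (f * f'), Linfty.coeFn_mul (g • f) (g • f'),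
      Linfty.coeFn_group_smul g f, Linfty.coeFn_group_smul g f',
      ae_smul g⁻¹ (Linfty.coeFn_mul f f')] with x h1 h2 h3 h4 h5
    rw [h1, h2, h3, h4, h5]

end Linfty

section Rank

variable {X : Type*} [MeasurableSpace X] {μ : Measure X} [IsProbabilityMeasure μ]

/-- The trace `τ(p) = ∫ p dμ` of `L^∞(X, μ)`, on projections (where it is real). -/
def trace (p : Linfty μ) : ℝ := (∫ x, p x ∂μ).re

/-- The algebraic tensor product `M ⊗ Mᵒ` over `ℂ`, for `M = L^∞(X, μ)`. An `M`-bimodule is a module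
over this ring. -/
def Enveloping (μ : Measure X) [IsProbabilityMeasure μ] : Type _ :=
  Linfty μ ⊗[ℂ] (Linfty μ)ᵐᵒᵖ

instance : CommRing (Enveloping μ) :=
  inferInstanceAs (CommRing (Linfty μ ⊗[ℂ] (Linfty μ)ᵐᵒᵖ))

/-- The element `a ⊗ bᵒ`, which acts on a bimodule by `ξ ↦ a ξ b`. -/
def lr (a b : Linfty μ) : Enveloping μ := a ⊗ₜ[ℂ] MulOpposite.op b

theorem lr_mul (a b c d : Linfty μ) : lr a b * lr c d = lr (a * c) (b * d) := by
  rw [mul_comm b d]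
  exact Algebra.TensorProduct.tmul_mul_tmul a c (MulOpposite.op b) (MulOpposite.op d)

theorem lr_zero (a : Linfty μ) : lr a 0 = 0 := TensorProduct.tmul_zero _ a

theorem zero_lr (b : Linfty μ) : lr 0 b = 0 := TensorProduct.zero_tmul _ (MulOpposite.op b)

variable {L : Type*} [AddCommGroup L] [Module (Enveloping μ) L]

variable (μ) in
/-- The values `τ(p) + τ(q)`, for an element `ξ` of an `L^∞(X)`-bimodule and projections `p, q` with `p^⊥ ξ q^⊥ = 0`. -/
def rankSet (ξ : L) : Set ℝ :=
  {t | ∃ p q : Linfty μ, IsStarProjection p ∧ IsStarProjection q ∧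
    lr (1 - p) (1 - q) • ξ = 0 ∧ t = trace p + trace q}

variable (μ) in
/-- `[ξ] = inf {τ(p) + τ(q) : p^⊥ ξ q^⊥ = 0}`. -/
def rank (ξ : L) : ℝ := sInf (rankSet μ ξ)

theorem isStarProjection_ae {p : Linfty μ} (hp : IsStarProjection p) :
    ∀ᵐ x ∂μ, p x = 0 ∨ p x = 1 := by
  have h := Linfty.coeFn_mul p p
  rw [hp.isIdempotentElem.eq] at h
  filter_upwards [h] with x hx
  by_cases h0 : p x = 0
  · exact Or.inl h0
  · exact Or.inr (mul_left_cancel₀ h0 (by rw [← hx, mul_one]))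

theorem trace_nonneg {p : Linfty μ} (hp : IsStarProjection p) : 0 ≤ trace p := by
  have hi : Integrable (fun x => p x) μ := (Lp.memLp p).integrable le_top
  have : trace p = ∫ x, (p x).re ∂μ := (integral_re hi).symm
  rw [this]
  apply integral_nonneg_of_ae
  filter_upwards [isStarProjection_ae hp] with x hx
  rcases hx with hx | hx <;> simp [hx]

theorem trace_add (f g : Linfty μ) : trace (f + g) = trace f + trace g := by
  unfold trace
  rw [integral_congr_ae (Lp.coeFn_add f g)]
  simp only [Pi.add_apply]
  rw [integral_add ((Lp.memLp f).integrable le_top) ((Lp.memLp g).integrable le_top),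
    Complex.add_re]

theorem star_mul_linfty (f g : Linfty μ) : star (f * g) = star f * star g := by
  apply Lp.ext
  filter_upwards [Lp.coeFn_star (f * g), Linfty.coeFn_mul f g,
    Linfty.coeFn_mul (star f) (star g), Lp.coeFn_star f, Lp.coeFn_star g] with x h1 h2 h3 h4 h5
  rw [h1, Pi.star_apply, h2, h3, h4, h5, Pi.star_apply, Pi.star_apply, star_mul']

theorem star_add_linfty (f g : Linfty μ) : star (f + g) = star f + star g := by
  apply Lp.ext
  filter_upwards [Lp.coeFn_star (f + g), Lp.coeFn_add f g,
    Lp.coeFn_add (star f) (star g), Lp.coeFn_star f, Lp.coeFn_star g] with x h1 h2 h3 h4 h5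
  rw [h1, Pi.star_apply, h2, h3, Pi.add_apply, Pi.add_apply, h4, h5, Pi.star_apply,
    Pi.star_apply, star_add]

theorem isStarProjection_mul {p q : Linfty μ} (hp : IsStarProjection p)
    (hq : IsStarProjection q) : IsStarProjection (p * q) := by
  refine ⟨?_, ?_⟩
  · have h1 := hp.isIdempotentElem.eq
    have h2 := hq.isIdempotentElem.eq
    change p * q * (p * q) = p * q
    rw [mul_mul_mul_comm, h1, h2]
  · change star (p * q) = p * q
    rw [star_mul_linfty, hp.isSelfAdjoint.star_eq, hq.isSelfAdjoint.star_eq]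

theorem isStarProjection_zero : IsStarProjection (0 : Linfty μ) := by
  refine ⟨zero_mul _, ?_⟩
  have h := star_add_linfty (0 : Linfty μ) 0
  rw [add_zero] at h
  exact left_eq_add.mp h

theorem isStarProjection_one_sub {p : Linfty μ} (hp : IsStarProjection p) :
    IsStarProjection (1 - p) := by
  refine ⟨?_, ?_⟩
  · have h1 := hp.isIdempotentElem.eq
    change (1 - p) * (1 - p) = 1 - p
    linear_combination h1
  · change star (1 - p) = 1 - p
    have h := star_add_linfty (1 - p) p
    rw [sub_add_cancel, hp.isSelfAdjoint.star_eq] at h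
    have h1 : star (1 : Linfty μ) = 1 := by
      have := star_mul_linfty (star (1 : Linfty μ)) 1
      rw [mul_one, star_star, one_mul] at this
      exact this.symm
    rw [h1] at h
    exact eq_sub_of_add_eq h.symm

/-- The join `p ∨ q` of two projections, with complement `p^⊥ q^⊥` and trace at most the sum. -/
theorem exists_join {p q : Linfty μ} (hp : IsStarProjection p) (hq : IsStarProjection q) :
    ∃ r : Linfty μ, IsStarProjection r ∧ 1 - r = (1 - p) * (1 - q) ∧
      trace r ≤ trace p + trace q := by
  refine ⟨1 - (1 - p) * (1 - q), isStarProjection_one_sub (isStarProjection_mul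
    (isStarProjection_one_sub hp) (isStarProjection_one_sub hq)), sub_sub_cancel _ _, ?_⟩
  have h1 : (1 - (1 - p) * (1 - q)) + p * q = p + q := by ring
  have h2 := trace_add (1 - (1 - p) * (1 - q)) (p * q)
  rw [h1, trace_add] at h2
  linarith [trace_nonneg (isStarProjection_mul hp hq)]

theorem rankSet_nonneg (ξ : L) {t : ℝ} (ht : t ∈ rankSet μ ξ) : 0 ≤ t := by
  obtain ⟨p, q, hp, hq, -, rfl⟩ := ht
  exact add_nonneg (trace_nonneg hp) (trace_nonneg hq)

theorem rankSet_nonempty (ξ : L) : (rankSet μ ξ).Nonempty :=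
  ⟨_, 1 - 0, 0, isStarProjection_one_sub isStarProjection_zero, isStarProjection_zero,
    by rw [sub_zero, sub_self, zero_lr, zero_smul], rfl⟩

theorem rank_nonneg (ξ : L) : 0 ≤ rank μ ξ :=
  Real.sInf_nonneg fun _ ht => rankSet_nonneg ξ ht

theorem rank_le {ξ : L} {t : ℝ} (ht : t ∈ rankSet μ ξ) : rank μ ξ ≤ t :=
  csInf_le ⟨0, fun _ h => rankSet_nonneg ξ h⟩ ht

theorem trace_zero : trace (0 : Linfty μ) = 0 := by
  have h := trace_add (0 : Linfty μ) 0
  rw [add_zero] at h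
  exact left_eq_add.mp h

theorem rank_zero : rank μ (0 : L) = 0 :=
  le_antisymm (rank_le ⟨0, 0, isStarProjection_zero, isStarProjection_zero, smul_zero _,
    by rw [trace_zero, add_zero]⟩) (rank_nonneg _)

theorem rank_neg (ξ : L) : rank μ (-ξ) = rank μ ξ := by
  unfold rank rankSet
  simp only [smul_neg, neg_eq_zero]

theorem rank_add_le (ξ η : L) : rank μ (ξ + η) ≤ rank μ ξ + rank μ η := by
  refine le_of_forall_pos_le_add fun ε hε => ?_
  obtain ⟨s, hs, hs'⟩ := exists_lt_of_csInf_lt (rankSet_nonempty (μ := μ) ξ)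
    (show rank μ ξ < rank μ ξ + ε / 2 by linarith)
  obtain ⟨t, ht, ht'⟩ := exists_lt_of_csInf_lt (rankSet_nonempty (μ := μ) η)
    (show rank μ η < rank μ η + ε / 2 by linarith)
  obtain ⟨p, q, hp, hq, h0, rfl⟩ := hs
  obtain ⟨p', q', hp', hq', h0', rfl⟩ := ht
  obtain ⟨P, hP, hP1, hPt⟩ := exists_join hp hp'
  obtain ⟨Q, hQ, hQ1, hQt⟩ := exists_join hq hq'
  have key : rank μ (ξ + η) ≤ trace P + trace Q := by
    refine rank_le ⟨P, Q, hP, hQ, ?_, rfl⟩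
    have e1 : lr (1 - P) (1 - Q) = lr (1 - p') (1 - q') * lr (1 - p) (1 - q) := by
      rw [lr_mul, hP1, hQ1, mul_comm (1 - p'), mul_comm (1 - q')]
    have e2 : lr (1 - P) (1 - Q) = lr (1 - p) (1 - q) * lr (1 - p') (1 - q') := by
      rw [e1, mul_comm]
    rw [smul_add]
    nth_rewrite 1 [e1]
    rw [e2, mul_smul, mul_smul, h0, h0', smul_zero, smul_zero, add_zero]
  linarith

theorem rank_smul_le (a : Enveloping μ) :
    ∃ C : ℝ, 0 ≤ C ∧ ∀ ξ : L, rank μ (a • ξ) ≤ C * rank μ ξ := by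
  induction a using TensorProduct.induction_on with
  | zero =>
    refine ⟨0, le_rfl, fun ξ => ?_⟩
    rw [show (0 : Linfty μ ⊗[ℂ] (Linfty μ)ᵐᵒᵖ) = (0 : Enveloping μ) from rfl, zero_smul, rank_zero,
      zero_mul]
  | tmul f g =>
    refine ⟨1, zero_le_one, fun ξ => ?_⟩
    rw [one_mul]
    refine csInf_le_csInf ⟨0, fun _ h => rankSet_nonneg _ h⟩ (rankSet_nonempty ξ) ?_
    rintro t ⟨p, q, hp, hq, h0, rfl⟩
    refine ⟨p, q, hp, hq, ?_, rfl⟩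
    change lr (1 - p) (1 - q) • (lr f g.unop • ξ) = 0
    rw [smul_smul, mul_comm, mul_smul, h0, smul_zero]
  | add a b ha hb =>
    obtain ⟨C, hC, h⟩ := ha
    obtain ⟨D, hD, h'⟩ := hb
    refine ⟨C + D, add_nonneg hC hD, fun ξ => ?_⟩
    rw [add_mul]
    change rank μ (((show Enveloping μ from a) + (show Enveloping μ from b)) • ξ) ≤ _
    rw [add_smul]
    exact (rank_add_le _ _).trans (add_le_add (h ξ) (h' ξ))

/-- Bimodule maps are contractions. -/
theorem rank_map_le {L' : Type*} [AddCommGroup L'] [Module (Enveloping μ) L']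
    (φ : L →ₗ[Enveloping μ] L') (ξ : L) : rank μ (φ ξ) ≤ rank μ ξ := by
  refine csInf_le_csInf ⟨0, fun _ h => rankSet_nonneg _ h⟩ (rankSet_nonempty ξ) ?_
  rintro t ⟨p, q, hp, hq, h0, rfl⟩
  refine ⟨p, q, hp, hq, ?_, rfl⟩
  rw [← map_smul, h0, map_zero]

variable (μ L) in
/-- `CS(L)`: the sequences in `L` that are Cauchy for the rank metric `d(ξ, η) = [ξ - η]`. -/
def cauchySeqs : Submodule (Enveloping μ) (ℕ → L) where
  carrier := {u | ∀ ε > 0, ∃ N, ∀ m ≥ N, ∀ n ≥ N, rank μ (u m - u n) < ε}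
  zero_mem' := fun ε hε => ⟨0, fun m _ n _ => by simpa [rank_zero] using hε⟩
  add_mem' := by
    intro u v hu hv ε hε
    obtain ⟨N, hN⟩ := hu (ε / 2) (half_pos hε)
    obtain ⟨N', hN'⟩ := hv (ε / 2) (half_pos hε)
    refine ⟨max N N', fun m hm n hn => ?_⟩
    have h1 := hN m (le_of_max_le_left hm) n (le_of_max_le_left hn)
    have h2 := hN' m (le_of_max_le_right hm) n (le_of_max_le_right hn)
    have h3 := rank_add_le (μ := μ) (u m - u n) (v m - v n)
    rw [Pi.add_apply, Pi.add_apply, add_sub_add_comm]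
    linarith
  smul_mem' := by
    intro a u hu ε hε
    obtain ⟨C, hC, h⟩ := rank_smul_le (μ := μ) (L := L) a
    obtain ⟨N, hN⟩ := hu (ε / (C + 1)) (by positivity)
    refine ⟨N, fun m hm n hn => ?_⟩
    have h1 := hN m hm n hn
    rw [lt_div_iff₀ (by positivity)] at h1
    have h2 := h (u m - u n)
    have h3 := rank_nonneg (μ := μ) (u m - u n)
    rw [Pi.smul_apply, Pi.smul_apply, ← smul_sub]
    nlinarith

variable (μ L) in
/-- `ZS(L)`: the Cauchy sequences that converge to `0` for the rank metric. -/
def nullSeqs : Submodule (Enveloping μ) (cauchySeqs μ L) where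
  carrier := {u | ∀ ε > 0, ∃ N, ∀ n ≥ N, rank μ (u.1 n) < ε}
  zero_mem' := fun ε hε => ⟨0, fun n _ => by simpa [rank_zero] using hε⟩
  add_mem' := by
    intro u v hu hv ε hε
    obtain ⟨N, hN⟩ := hu (ε / 2) (half_pos hε)
    obtain ⟨N', hN'⟩ := hv (ε / 2) (half_pos hε)
    refine ⟨max N N', fun n hn => ?_⟩
    have h1 := hN n (le_of_max_le_left hn)
    have h2 := hN' n (le_of_max_le_right hn)
    have h3 := rank_add_le (μ := μ) (u.1 n) (v.1 n)
    change rank μ (u.1 n + v.1 n) < ε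
    linarith
  smul_mem' := by
    intro a u hu ε hε
    obtain ⟨C, hC, h⟩ := rank_smul_le (μ := μ) (L := L) a
    obtain ⟨N, hN⟩ := hu (ε / (C + 1)) (by positivity)
    refine ⟨N, fun n hn => ?_⟩
    have h1 := hN n hn
    rw [lt_div_iff₀ (by positivity)] at h1
    have h2 := h (u.1 n)
    have h3 := rank_nonneg (μ := μ) (u.1 n)
    change rank μ (a • u.1 n) < ε
    nlinarith

variable (μ L) in
/-- The completion `c(L) = CS(L) / ZS(L)`, again a bimodule. -/
abbrev Completion : Type _ := cauchySeqs μ L ⧸ nullSeqs μ L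

variable {L' : Type*} [AddCommGroup L'] [Module (Enveloping μ) L']

/-- A bimodule map `L → L'` applied termwise to Cauchy sequences. -/
def cauchyMap (φ : L →ₗ[Enveloping μ] L') :
    cauchySeqs μ L →ₗ[Enveloping μ] cauchySeqs μ L' :=
  (φ.compLeft ℕ).restrict (by
    intro u hu ε hε
    obtain ⟨N, hN⟩ := hu ε hε
    refine ⟨N, fun m hm n hn => lt_of_le_of_lt ?_ (hN m hm n hn)⟩
    change rank μ (φ (u m) - φ (u n)) ≤ _
    rw [← map_sub]
    exact rank_map_le φ _)

/-- The map `c(φ) : c(L) → c(L')` induced on completions by a bimodule map `φ : L → L'`. -/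
def Completion.map (φ : L →ₗ[Enveloping μ] L') :
    Completion μ L →ₗ[Enveloping μ] Completion μ L' :=
  (nullSeqs μ L).mapQ (nullSeqs μ L') (cauchyMap φ) (by
    intro u hu ε hε
    obtain ⟨N, hN⟩ := hu ε hε
    exact ⟨N, fun n hn => lt_of_le_of_lt (rank_map_le φ _) (hN n hn)⟩)

variable (μ) in
/-- The multiplication homomorphism `M ⊗ Mᵒ → M`, `a ⊗ bᵒ ↦ ab`, of `M = L^∞(X, μ)`. -/
def envelopingMul : Enveloping μ →+* Linfty μ :=
  (Algebra.TensorProduct.lift (AlgHom.id ℂ (Linfty μ))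
    ((AlgEquiv.toOpposite ℂ (Linfty μ)).symm : (Linfty μ)ᵐᵒᵖ →ₐ[ℂ] Linfty μ)
    (fun _ _ => mul_comm _ _)).toRingHom

/-- An `L^∞(X)`-module `L`, regarded as a bimodule through the diagonal left action: both
actions are the given one, `a · ξ · b = (ab) ξ`. -/
def Diag (L : Type*) : Type _ := L

section Diag

variable {L : Type*} [AddCommGroup L] [Module (Linfty μ) L]
variable {L' : Type*} [AddCommGroup L'] [Module (Linfty μ) L']

instance : AddCommGroup (Diag L) := inferInstanceAs (AddCommGroup L)

instance : Module (Enveloping μ) (Diag L) :=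
  Module.compHom L (envelopingMul μ)

/-- A left-linear map is a bimodule map for the diagonal structures. -/
def Diag.map (φ : L →ₗ[Linfty μ] L') : Diag L →ₗ[Enveloping μ] Diag L' where
  toFun := φ
  map_add' := φ.map_add
  map_smul' a ξ := φ.map_smul (envelopingMul μ a) ξ

end Diag

end Rank

section Relation

variable (Γ X : Type*) [Group Γ] [MulAction Γ X]

/-- The orbit equivalence relation `R_ρ = {(x, g • x)} ⊆ X × X`. -/
def orbitRelation : Set (X × X) := {z | ∃ g : Γ, z.2 = g • z.1}

variable {X}

/-- A local isomorphism from `R`: a bijection between two measurable subsets of `X`, measurable in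
both directions, whose graph is contained in `R`. -/
structure LocalIso [MeasurableSpace X] (R : Set (X × X)) extends PartialEquiv X X where
  measurable_toFun : ∀ E, MeasurableSet E → MeasurableSet (source ∩ toFun ⁻¹' E)
  measurable_invFun : ∀ E, MeasurableSet E → MeasurableSet (target ∩ invFun ⁻¹' E)
  graph_mem : ∀ x ∈ source, (x, toFun x) ∈ R

variable {Γ} [MeasurableSpace X]

theorem mk_smul_mem_orbitRelation (g : Γ) (x : X) : (x, g • x) ∈ orbitRelation Γ X := ⟨g, rfl⟩

theorem orbitRelation_trans {x y z : X} (h : (x, y) ∈ orbitRelation Γ X) :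
    (x, z) ∈ orbitRelation Γ X ↔ (y, z) ∈ orbitRelation Γ X := by
  obtain ⟨g, rfl : y = g • x⟩ := h
  constructor
  · rintro ⟨k, rfl : z = k • x⟩
    exact ⟨k * g⁻¹, by simp [mul_smul]⟩
  · rintro ⟨k, rfl : z = k • (g • x)⟩
    exact ⟨k * g, by simp [mul_smul]⟩

theorem LocalIso.measurableSet_source {R : Set (X × X)} (φ : LocalIso R) :
    MeasurableSet φ.source := by
  simpa using φ.measurable_toFun univ MeasurableSet.univ

theorem LocalIso.measurableSet_target {R : Set (X × X)} (φ : LocalIso R) :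
    MeasurableSet φ.target := by
  simpa using φ.measurable_invFun univ MeasurableSet.univ

/-- The local isomorphism `x ↦ g • x` implemented by a group element. -/
def LocalIso.ofGroup [MeasurableConstSMul Γ X] (g : Γ) : LocalIso (orbitRelation Γ X) where
  toPartialEquiv := (MulAction.toPerm g).toPartialEquiv
  measurable_toFun E hE := by
    exact MeasurableSet.univ.inter (measurable_const_smul g hE)
  measurable_invFun E hE := by
    exact MeasurableSet.univ.inter (measurable_const_smul g⁻¹ hE)
  graph_mem x _ := mk_smul_mem_orbitRelation g x

/-- The composition `φ ∘ ψ`, on its natural domain. -/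
def LocalIso.comp (φ ψ : LocalIso (orbitRelation Γ X)) : LocalIso (orbitRelation Γ X) where
  toPartialEquiv := ψ.toPartialEquiv.trans φ.toPartialEquiv
  measurable_toFun E hE := by
    have := ψ.measurable_toFun _ (φ.measurable_toFun E hE)
    convert this using 1
    ext x
    exact and_assoc
  measurable_invFun E hE := by
    have := φ.measurable_invFun _ (ψ.measurable_invFun E hE)
    convert this using 1
    ext x
    exact and_assoc
  graph_mem x hx :=
    (orbitRelation_trans (ψ.graph_mem x hx.1)).2 (φ.graph_mem _ hx.2)

/-- The inverse of a local isomorphism, extended by the identity to all of `X`. -/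
def LocalIso.invExt {R : Set (X × X)} (φ : LocalIso R) : X → X :=
  open Classical in φ.target.piecewise φ.invFun id

theorem LocalIso.invExt_of_mem {R : Set (X × X)} (φ : LocalIso R) {x : X} (hx : x ∈ φ.target) :
    φ.invExt x = φ.invFun x := by
  simp [LocalIso.invExt, hx]

theorem LocalIso.measurable_invExt {R : Set (X × X)} (φ : LocalIso R) : Measurable φ.invExt := by
  intro E hE
  have : φ.invExt ⁻¹' E = (φ.target ∩ φ.invFun ⁻¹' E) ∪ (E \ φ.target) := by
    ext x
    by_cases hx : x ∈ φ.target <;> simp [LocalIso.invExt, hx]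
  rw [this]
  exact (φ.measurable_invFun E hE).union (hE.diff φ.measurableSet_target)

theorem LocalIso.invExt_orbit (φ : LocalIso (orbitRelation Γ X)) {x : X} (hx : x ∈ φ.target)
    (y : X) : (φ.invExt x, y) ∈ orbitRelation Γ X ↔ (x, y) ∈ orbitRelation Γ X := by
  have h := φ.graph_mem _ (φ.map_target' hx)
  rw [φ.right_inv' hx] at h
  rw [φ.invExt_of_mem hx]
  exact orbitRelation_trans h

variable [StandardBorelSpace X] [Countable Γ] [MeasurableConstSMul Γ X]

theorem measurableSet_orbitRelation : MeasurableSet (orbitRelation Γ X) := by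
  have : orbitRelation Γ X = ⋃ g : Γ, {z : X × X | z.2 = g • z.1} := by
    ext z; simp [orbitRelation]
  rw [this]
  exact MeasurableSet.iUnion fun g =>
    measurableSet_eq_fun measurable_snd (measurable_fst.const_smul g)

theorem exists_first (e : Γ → ℕ) {P : Γ → Prop} (h : ∃ g, P g) :
    ∃ g, P g ∧ ∀ k, e k < e g → ¬ P k := by
  obtain ⟨g, hg, hmin⟩ := (InvImage.wf e Nat.lt_wfRel.wf).has_min {g | P g} h
  exact ⟨g, hg, fun k hk hP => hmin k hP hk⟩

theorem measurable_count_section {C : Set (X × X)} (hC : MeasurableSet C) :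
    Measurable fun x => Measure.count {y | (x, y) ∈ C ∩ orbitRelation Γ X} := by
  obtain ⟨e, he⟩ := exists_injective_nat Γ
  let D : Γ → Set X := fun g =>
    {x | (x, g • x) ∈ C} ∩ ⋂ k : Γ, {x | e k < e g → k • x ≠ g • x}
  have hD : ∀ g, MeasurableSet (D g) := by
    intro g
    refine MeasurableSet.inter (measurable_id.prodMk (measurable_const_smul g) hC)
      (MeasurableSet.iInter fun k => ?_)
    by_cases hk : e k < e g
    · simp only [hk, true_imp_iff]
      exact (measurableSet_eq_fun (measurable_const_smul k) (measurable_const_smul g)).compl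
    · simp [hk]
  have key : ∀ x, Measure.count {y | (x, y) ∈ C ∩ orbitRelation Γ X} =
      ∑' g, (D g).indicator (fun _ => (1 : ℝ≥0∞)) x := by
    intro x
    have hU : {y | (x, y) ∈ C ∩ orbitRelation Γ X} = ⋃ g : Γ, {y | y = g • x ∧ x ∈ D g} := by
      ext y
      rw [mem_iUnion]
      constructor
      · rintro ⟨hy, hR⟩
        obtain ⟨g, hg, hmin⟩ := exists_first (P := fun g : Γ => y = g • x) e hR
        refine ⟨g, hg, ?_, mem_iInter.2 fun k hk hkg => hmin k hk (hg.trans hkg.symm)⟩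
        change (x, g • x) ∈ C
        rwa [← hg]
      · rintro ⟨g, rfl, hg⟩
        exact ⟨hg.1, g, rfl⟩
    rw [hU, measure_iUnion]
    · refine tsum_congr fun g => ?_
      by_cases hx : x ∈ D g
      · simp [hx]
      · simp [hx]
    · intro g k hgk
      rw [Function.onFun, Set.disjoint_left]
      rintro y ⟨rfl, hg⟩ ⟨hgk', hk⟩
      rcases lt_trichotomy (e g) (e k) with h | h | h
      · exact mem_iInter.1 hk.2 g h hgk'
      · exact hgk (he h)
      · exact mem_iInter.1 hg.2 k h hgk'.symm
    · intro g
      exact (Set.subsingleton_singleton.anti (fun y hy => hy.1)).measurableSet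
  simp_rw [key]
  exact Measurable.tsum fun g => measurable_const.indicator (hD g)

theorem measurableSet_section {C : Set (X × X)} (hC : MeasurableSet C) (x : X) :
    MeasurableSet {y | (x, y) ∈ C ∩ orbitRelation Γ X} :=
  measurable_prodMk_left (hC.inter measurableSet_orbitRelation)

variable (Γ) in
/-- The counting measure `m(C) = ∫ #{y : (x, y) ∈ C ∩ R_ρ} dμ(x)` of the orbit relation, as a
measure on `X × X` that is concentrated on `R_ρ`. -/
def orbitMeasure (μ : Measure X) : Measure (X × X) :=
  Measure.ofMeasurable
    (fun C _ => ∫⁻ x, Measure.count {y | (x, y) ∈ C ∩ orbitRelation Γ X} ∂μ)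
    (by simp)
    (by
      intro C hC hd
      rw [← lintegral_tsum fun i => (measurable_count_section (hC i)).aemeasurable]
      refine lintegral_congr fun x => ?_
      rw [← measure_iUnion]
      · congr 1
        ext y
        simp
      · intro i j hij
        rw [Function.onFun, Set.disjoint_left]
        rintro y hy hy'
        exact Set.disjoint_left.1 (hd hij) hy.1 hy'.1
      · exact fun i => measurableSet_section (hC i) x)

variable {μ : Measure X}

theorem orbitMeasure_apply {C : Set (X × X)} (hC : MeasurableSet C) :
    orbitMeasure Γ μ C = ∫⁻ x, Measure.count {y | (x, y) ∈ C ∩ orbitRelation Γ X} ∂μ :=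
  Measure.ofMeasurable_apply C hC

theorem orbitMeasure_fst_preimage {E : Set X} (hE : MeasurableSet E) {C : Set (X × X)}
    (hC : MeasurableSet C) : orbitMeasure Γ μ (Prod.fst ⁻¹' E ∩ C) =
      ∫⁻ x in E, Measure.count {y | (x, y) ∈ C ∩ orbitRelation Γ X} ∂μ := by
  rw [orbitMeasure_apply ((measurable_fst hE).inter hC), ← lintegral_indicator hE]
  refine lintegral_congr fun x => ?_
  by_cases hx : x ∈ E <;> simp [hx]

theorem ae_orbitMeasure_fst {P : X → Prop} (h : ∀ᵐ x ∂μ, P x) :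
    ∀ᵐ z ∂(orbitMeasure Γ μ), P z.1 := by
  obtain ⟨N, hN, hNm, hN0⟩ := exists_measurable_superset_of_null (ae_iff.1 h)
  refine ae_iff.2 (measure_mono_null (t := Prod.fst ⁻¹' N ∩ univ)
    (fun z hz => ⟨hN hz, mem_univ _⟩) ?_)
  rw [orbitMeasure_fst_preimage hNm MeasurableSet.univ]
  exact setLIntegral_measure_zero N _ hN0

variable [SMulInvariantMeasure Γ X μ]

/-- Local isomorphisms of the orbit relation preserve the measure. -/
theorem LocalIso.measurePreserving (φ : LocalIso (orbitRelation Γ X)) :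
    MeasurePreserving φ.invExt (μ.restrict φ.target) (μ.restrict φ.source) := by
  refine ⟨φ.measurable_invExt, ?_⟩
  ext E hE
  rw [Measure.map_apply φ.measurable_invExt hE, Measure.restrict_apply (φ.measurable_invExt hE),
    Measure.restrict_apply hE]
  obtain ⟨e, he⟩ := exists_injective_nat Γ
  let T : Γ → Set X := fun g =>
    (φ.target ∩ {x | φ.invExt x = g • x}) ∩ ⋂ k : Γ, {x | e k < e g → φ.invExt x ≠ k • x}
  have hT : ∀ g, MeasurableSet (T g) := by
    intro g
    refine (φ.measurableSet_target.inter
      (measurableSet_eq_fun φ.measurable_invExt (measurable_const_smul g))).inter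
      (MeasurableSet.iInter fun k => ?_)
    by_cases hk : e k < e g
    · simp only [hk, true_imp_iff]
      exact (measurableSet_eq_fun φ.measurable_invExt (measurable_const_smul k)).compl
    · simp [hk]
  have hTd : ∀ {g k x}, x ∈ T g → x ∈ T k → g = k := by
    intro g k x hg hk
    rcases lt_trichotomy (e g) (e k) with h | h | h
    · exact absurd hg.1.2 (mem_iInter.1 hk.2 g h)
    · exact he h
    · exact absurd hk.1.2 (mem_iInter.1 hg.2 k h)
  have hTex : ∀ x ∈ φ.target, ∃ g, x ∈ T g := by
    intro x hx
    obtain ⟨g, hg, hmin⟩ := exists_first (P := fun g : Γ => φ.invExt x = g • x) e (by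
      obtain ⟨g, hg⟩ := (φ.invExt_orbit hx (φ.invExt x)).1 ⟨1, (one_smul _ _).symm⟩
      exact ⟨g, hg⟩)
    exact ⟨g, ⟨hx, hg⟩, mem_iInter.2 fun k hk => hmin k hk⟩
  have h1 : φ.invExt ⁻¹' E ∩ φ.target = ⋃ g, T g ∩ (g • ·) ⁻¹' E := by
    ext x
    simp only [mem_inter_iff, mem_preimage, mem_iUnion]
    constructor
    · rintro ⟨hx, hxt⟩
      obtain ⟨g, hg⟩ := hTex x hxt
      exact ⟨g, hg, hg.1.2 ▸ hx⟩
    · rintro ⟨g, hg, hx⟩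
      exact ⟨hg.1.2.symm ▸ hx, hg.1.1⟩
  have h2 : E ∩ φ.source = ⋃ g : Γ, (g⁻¹ • ·) ⁻¹' (T g) ∩ E := by
    ext y
    simp only [mem_inter_iff, mem_preimage, mem_iUnion]
    constructor
    · rintro ⟨hy, hys⟩
      obtain ⟨g, hg⟩ := hTex _ (φ.map_source' hys)
      refine ⟨g, ?_, hy⟩
      have h : φ.invExt (φ.toFun y) = g • φ.toFun y := hg.1.2
      rw [φ.invExt_of_mem (φ.map_source' hys), φ.left_inv' hys] at h
      have h' : g⁻¹ • y = φ.toFun y := by rw [inv_smul_eq_iff]; exact h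
      rwa [h']
    · rintro ⟨g, hg, hy⟩
      refine ⟨hy, ?_⟩
      have h : φ.invExt (g⁻¹ • y) = g • (g⁻¹ • y) := hg.1.2
      rw [smul_inv_smul, φ.invExt_of_mem hg.1.1] at h
      rw [← h]
      exact φ.map_target' hg.1.1
  rw [h1, h2, measure_iUnion, measure_iUnion]
  · refine tsum_congr fun g => ?_
    rw [← measure_preimage_smul μ g⁻¹ (T g ∩ (g • ·) ⁻¹' E)]
    congr 1
    ext y
    simp
  · intro g k hgk
    rw [Function.onFun, Set.disjoint_left]
    rintro y ⟨hg, -⟩ ⟨hk, -⟩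
    have hg1 : φ.invExt (g⁻¹ • y) = g • (g⁻¹ • y) := hg.1.2
    have hk1 : φ.invExt (k⁻¹ • y) = k • (k⁻¹ • y) := hk.1.2
    rw [smul_inv_smul, φ.invExt_of_mem hg.1.1] at hg1
    rw [smul_inv_smul, φ.invExt_of_mem hk.1.1] at hk1
    have hgk' : g⁻¹ • y = k⁻¹ • y :=
      (φ.right_inv' hg.1.1).symm.trans
        ((congrArg φ.toFun (hg1.trans hk1.symm)).trans (φ.right_inv' hk.1.1))
    refine hgk (hTd hg ?_)
    change g⁻¹ • y ∈ T k
    rw [hgk']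
    exact hk
  · exact fun g => ((measurable_const_smul g⁻¹) (hT g)).inter hE
  · intro g k hgk
    rw [Function.onFun, Set.disjoint_left]
    rintro y ⟨hg, -⟩ ⟨hk, -⟩
    exact hgk (hTd hg hk)
  · exact fun g => (hT g).inter ((measurable_const_smul g) hE)

theorem LocalIso.measurePreserving_prod (φ : LocalIso (orbitRelation Γ X)) :
    MeasurePreserving (Prod.map φ.invExt id)
      ((orbitMeasure Γ μ).restrict (Prod.fst ⁻¹' φ.target))
      ((orbitMeasure Γ μ).restrict (Prod.fst ⁻¹' φ.source)) := by
  have hS : Measurable (Prod.map φ.invExt (id : X → X)) := φ.measurable_invExt.prodMap measurable_id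
  refine ⟨hS, ?_⟩
  ext C hC
  rw [Measure.map_apply hS hC, Measure.restrict_apply (hS hC), Measure.restrict_apply hC,
    inter_comm, orbitMeasure_fst_preimage φ.measurableSet_target (hS hC), inter_comm C,
    orbitMeasure_fst_preimage φ.measurableSet_source hC,
    ← φ.measurePreserving.lintegral_comp (measurable_count_section hC)]
  refine setLIntegral_congr_fun φ.measurableSet_target fun x hx => ?_
  congr 1
  ext y
  exact and_congr_right fun _ => (φ.invExt_orbit hx y).symm

theorem LocalIso.ae_pull (φ : LocalIso (orbitRelation Γ X)) {P : X × X → Prop}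
    (h : ∀ᵐ z ∂(orbitMeasure Γ μ), P z) :
    ∀ᵐ z ∂(orbitMeasure Γ μ), z.1 ∈ φ.target → P (φ.invFun z.1, z.2) := by
  have h1 := φ.measurePreserving_prod.quasiMeasurePreserving.ae
    (ae_restrict_of_ae (s := Prod.fst ⁻¹' φ.source) h)
  rw [ae_restrict_iff' (measurable_fst φ.measurableSet_target)] at h1
  filter_upwards [h1] with z hz hzt
  have := hz hzt
  rwa [Prod.map, φ.invExt_of_mem hzt] at this

theorem LocalIso.ae_pull_base (φ : LocalIso (orbitRelation Γ X)) {P : X → Prop}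
    (h : ∀ᵐ x ∂μ, P x) : ∀ᵐ x ∂μ, x ∈ φ.target → P (φ.invFun x) := by
  have h1 := φ.measurePreserving.quasiMeasurePreserving.ae
    (ae_restrict_of_ae (s := φ.source) h)
  rw [ae_restrict_iff' φ.measurableSet_target] at h1
  filter_upwards [h1] with z hz hzt
  have := hz hzt
  rwa [φ.invExt_of_mem hzt] at this

end Relation

section RelationRing

variable (Γ : Type*) {X : Type*} [Group Γ] [MulAction Γ X] [MeasurableSpace X]
  [StandardBorelSpace X] [Countable Γ] [MeasurableConstSMul Γ X] (μ : Measure X)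

/-- The Hilbert space `L²(R_ρ, m)`. -/
abbrev HilbertR : Type _ := Lp ℂ 2 (orbitMeasure Γ μ)

variable {Γ μ}

theorem memLp_fst (f : Linfty μ) : MemLp (fun z : X × X => f z.1) ∞ (orbitMeasure Γ μ) := by
  have hq : Measure.QuasiMeasurePreserving (Prod.fst : X × X → X) (orbitMeasure Γ μ) μ := by
    refine ⟨measurable_fst, Measure.AbsolutelyContinuous.mk fun N hN h0 => ?_⟩
    rw [Measure.map_apply measurable_fst hN]
    have := ae_orbitMeasure_fst (Γ := Γ) (measure_eq_zero_iff_ae_notMem.1 h0)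
    exact measure_eq_zero_iff_ae_notMem.2 this
  refine memLp_top_of_bound ((Lp.aestronglyMeasurable f).comp_quasiMeasurePreserving hq) ‖f‖ ?_
  refine ae_orbitMeasure_fst (P := fun x => ‖f x‖ ≤ ‖f‖) ?_
  rw [Lp.norm_def]
  have hf : eLpNormEssSup f μ ≠ ∞ := by
    simpa [eLpNorm_exponent_top] using Lp.eLpNorm_ne_top f
  filter_upwards [enorm_ae_le_eLpNormEssSup f μ] with x hx
  rw [eLpNorm_exponent_top]
  simpa using ENNReal.toReal_mono hf hx

variable (Γ) in
/-- `f ∈ L^∞(X)` as an operator on `L²(R_ρ, m)`: `(f ξ)(x, y) = f(x) ξ(x, y)`. -/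
def mulOp (f : Linfty μ) : HilbertR Γ μ →L[ℂ] HilbertR Γ μ :=
  (ContinuousLinearMap.mul ℂ ℂ).holderL (orbitMeasure Γ μ) ∞ 2 2
    ((memLp_fst f).toLp fun z => f z.1)

theorem coeFn_mulOp (f : Linfty μ) (ξ : HilbertR Γ μ) :
    ⇑(mulOp Γ f ξ) =ᵐ[orbitMeasure Γ μ] fun z => f z.1 * ξ z := by
  have h := (ContinuousLinearMap.mul ℂ ℂ).coeFn_holder (r := 2)
    ((memLp_fst (Γ := Γ) f).toLp fun z => f z.1) ξ
  filter_upwards [h, (memLp_fst (Γ := Γ) f).coeFn_toLp] with z h1 h2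
  exact h1.trans (by rw [h2]; rfl)

variable [SMulInvariantMeasure Γ X μ]

theorem LocalIso.eLpNorm_pull_le (φ : LocalIso (orbitRelation Γ X)) (ξ : HilbertR Γ μ) :
    MemLp ((Prod.fst ⁻¹' φ.target).indicator fun z => ξ (φ.invFun z.1, z.2)) 2
        (orbitMeasure Γ μ) ∧
      eLpNorm ((Prod.fst ⁻¹' φ.target).indicator fun z => ξ (φ.invFun z.1, z.2)) 2
        (orbitMeasure Γ μ) ≤ eLpNorm ξ 2 (orbitMeasure Γ μ) := by
  have hT : MeasurableSet (Prod.fst ⁻¹' φ.target : Set (X × X)) :=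
    measurable_fst φ.measurableSet_target
  have h0 : (Prod.fst ⁻¹' φ.target).indicator (fun z => ξ (φ.invFun z.1, z.2)) =
      (Prod.fst ⁻¹' φ.target).indicator (ξ ∘ Prod.map φ.invExt id) := by
    ext z
    by_cases hz : z.1 ∈ φ.target
    · rw [indicator_of_mem (s := Prod.fst ⁻¹' φ.target) hz,
        indicator_of_mem (s := Prod.fst ⁻¹' φ.target) hz, Function.comp_apply, Prod.map,
        φ.invExt_of_mem hz, id]
    · simp [hz]
  have hξ : MemLp ξ 2 ((orbitMeasure Γ μ).restrict (Prod.fst ⁻¹' φ.source)) :=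
    (Lp.memLp ξ).restrict _
  have hc := hξ.comp_measurePreserving φ.measurePreserving_prod
  rw [h0]
  refine ⟨(memLp_indicator_iff_restrict hT).2 hc, ?_⟩
  rw [eLpNorm_indicator_eq_eLpNorm_restrict hT,
    eLpNorm_comp_measurePreserving hξ.1 φ.measurePreserving_prod]
  exact eLpNorm_mono_measure _ Measure.restrict_le_self

variable (μ) in
/-- A local isomorphism `φ` as a (partial isometric) operator on `L²(R_ρ, m)`:
`(φ ξ)(x, y) = ξ(φ⁻¹ x, y)` if `x` is in the range of `φ`, and `0` otherwise. -/
def isoOp (φ : LocalIso (orbitRelation Γ X)) : HilbertR Γ μ →L[ℂ] HilbertR Γ μ :=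
  LinearMap.mkContinuous
    { toFun := fun ξ => (φ.eLpNorm_pull_le ξ).1.toLp _
      map_add' := fun ξ η => by
        rw [← MemLp.toLp_add]
        apply MemLp.toLp_congr
        filter_upwards [φ.ae_pull (Lp.coeFn_add ξ η)] with z hz
        by_cases hzt : z.1 ∈ φ.target
        · rw [Pi.add_apply, indicator_of_mem (s := Prod.fst ⁻¹' φ.target) hzt,
            indicator_of_mem (s := Prod.fst ⁻¹' φ.target) hzt,
            indicator_of_mem (s := Prod.fst ⁻¹' φ.target) hzt, hz hzt, Pi.add_apply]
        · simp [hzt]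
      map_smul' := fun c ξ => by
        rw [RingHom.id_apply, ← MemLp.toLp_const_smul]
        apply MemLp.toLp_congr
        filter_upwards [φ.ae_pull (Lp.coeFn_smul c ξ)] with z hz
        by_cases hzt : z.1 ∈ φ.target
        · rw [Pi.smul_apply, indicator_of_mem (s := Prod.fst ⁻¹' φ.target) hzt,
            indicator_of_mem (s := Prod.fst ⁻¹' φ.target) hzt, hz hzt, Pi.smul_apply]
        · simp [hzt] } 1
    (fun ξ => by
      rw [one_mul]
      change ‖(φ.eLpNorm_pull_le ξ).1.toLp _‖ ≤ _
      rw [Lp.norm_toLp, Lp.norm_def]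
      exact ENNReal.toReal_mono (Lp.eLpNorm_ne_top ξ) (φ.eLpNorm_pull_le ξ).2)

theorem coeFn_isoOp (φ : LocalIso (orbitRelation Γ X)) (ξ : HilbertR Γ μ) :
    ⇑(isoOp μ φ ξ) =ᵐ[orbitMeasure Γ μ]
      (Prod.fst ⁻¹' φ.target).indicator fun z => ξ (φ.invFun z.1, z.2) :=
  MemLp.coeFn_toLp (φ.eLpNorm_pull_le ξ).1

theorem isoOp_comp (φ ψ : LocalIso (orbitRelation Γ X)) :
    isoOp μ (φ.comp ψ) = isoOp μ φ * isoOp μ ψ := by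
  ext1 ξ
  apply Lp.ext
  filter_upwards [coeFn_isoOp (φ.comp ψ) ξ, coeFn_isoOp φ (isoOp μ ψ ξ),
    φ.ae_pull (coeFn_isoOp ψ ξ)] with z h1 h2 h3
  rw [h1, mul_apply_eq_comp, h2]
  by_cases hz : z.1 ∈ φ.target
  · rw [indicator_of_mem (s := Prod.fst ⁻¹' φ.target) hz, h3 hz]
    by_cases hz' : φ.invFun z.1 ∈ ψ.target
    · rw [indicator_of_mem (s := Prod.fst ⁻¹' (φ.comp ψ).target) ⟨hz, hz'⟩,
        indicator_of_mem (s := Prod.fst ⁻¹' ψ.target) hz']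
      rfl
    · rw [indicator_of_notMem (s := Prod.fst ⁻¹' (φ.comp ψ).target) fun h => hz' h.2,
        indicator_of_notMem (s := Prod.fst ⁻¹' ψ.target) hz']
  · rw [indicator_of_notMem (s := Prod.fst ⁻¹' (φ.comp ψ).target) fun h => hz h.1,
      indicator_of_notMem (s := Prod.fst ⁻¹' φ.target) hz]

variable [IsProbabilityMeasure μ]

theorem mulOp_one : mulOp Γ (1 : Linfty μ) = 1 := by
  ext1 ξ
  apply Lp.ext
  filter_upwards [coeFn_mulOp (1 : Linfty μ) ξ,
    ae_orbitMeasure_fst (Γ := Γ) (Linfty.coeFn_one (μ := μ))] with z h1 h2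
  rw [h1, h2, one_mul, one_apply_eq_self]

theorem mulOp_mul (f g : Linfty μ) : mulOp Γ (f * g) = mulOp Γ f * mulOp Γ g := by
  ext1 ξ
  apply Lp.ext
  filter_upwards [coeFn_mulOp (f * g) ξ, coeFn_mulOp f (mulOp Γ g ξ), coeFn_mulOp g ξ,
    ae_orbitMeasure_fst (Γ := Γ) (Linfty.coeFn_mul f g)] with z h1 h2 h3 h4
  rw [h1, h4, mul_apply_eq_comp, h2, h3, mul_assoc]

theorem mulOp_add (f g : Linfty μ) : mulOp Γ (f + g) = mulOp Γ f + mulOp Γ g := by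
  ext1 ξ
  apply Lp.ext
  rw [add_apply]
  filter_upwards [coeFn_mulOp (f + g) ξ, coeFn_mulOp f ξ, coeFn_mulOp g ξ,
    ae_orbitMeasure_fst (Γ := Γ) (Lp.coeFn_add f g),
    Lp.coeFn_add (mulOp Γ f ξ) (mulOp Γ g ξ)] with z h1 h2 h3 h4 h5
  rw [h1, h4, h5, Pi.add_apply, Pi.add_apply, h2, h3, add_mul]

theorem mulOp_smul (c : ℂ) (f : Linfty μ) : mulOp Γ (c • f) = c • mulOp Γ f := by
  ext1 ξ
  apply Lp.ext
  rw [smul_apply]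
  filter_upwards [coeFn_mulOp (c • f) ξ, coeFn_mulOp f ξ,
    ae_orbitMeasure_fst (Γ := Γ) (Lp.coeFn_smul c f),
    Lp.coeFn_smul c (mulOp Γ f ξ)] with z h1 h2 h4 h5
  rw [h1, h4, h5, Pi.smul_apply, Pi.smul_apply, h2, smul_eq_mul, smul_eq_mul, mul_assoc]

theorem isoOp_ofGroup_one : isoOp μ (LocalIso.ofGroup (1 : Γ)) = 1 := by
  ext1 ξ
  apply Lp.ext
  filter_upwards [coeFn_isoOp (LocalIso.ofGroup (1 : Γ)) ξ] with z h1
  rw [h1, one_apply_eq_self]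
  simp [LocalIso.ofGroup]

theorem isoOp_ofGroup_mul (g h : Γ) : isoOp μ (LocalIso.ofGroup (g * h)) =
    isoOp μ (LocalIso.ofGroup g) * isoOp μ (LocalIso.ofGroup h) := by
  rw [← isoOp_comp]
  ext1 ξ
  apply Lp.ext
  filter_upwards [coeFn_isoOp (LocalIso.ofGroup (g * h)) ξ,
    coeFn_isoOp ((LocalIso.ofGroup g).comp (LocalIso.ofGroup h)) ξ] with z h1 h2
  rw [h1, h2]
  simp [LocalIso.ofGroup, LocalIso.comp, mul_smul]

/-- Operators of local isomorphisms normalise `L^∞(X)`: `φ f = (f ∘ φ⁻¹) φ`. -/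
theorem exists_isoOp_mul_mulOp (φ : LocalIso (orbitRelation Γ X)) (f : Linfty μ) :
    ∃ f' : Linfty μ, isoOp μ φ * mulOp Γ f = mulOp Γ f' * isoOp μ φ := by
  have hf : MemLp f ∞ (μ.restrict φ.source) := (Lp.memLp f).restrict _
  have hc := hf.comp_measurePreserving φ.measurePreserving
  have hm := (memLp_indicator_iff_restrict φ.measurableSet_target).2 hc
  refine ⟨hm.toLp _, ?_⟩
  ext1 ξ
  apply Lp.ext
  rw [mul_apply_eq_comp, mul_apply_eq_comp]
  filter_upwards [coeFn_isoOp φ (mulOp Γ f ξ), φ.ae_pull (coeFn_mulOp f ξ),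
    coeFn_mulOp (hm.toLp _) (isoOp μ φ ξ), coeFn_isoOp φ ξ,
    ae_orbitMeasure_fst (Γ := Γ) hm.coeFn_toLp] with z h1 h2 h3 h4 h5
  rw [h1, h3, h4, h5]
  by_cases hz : z.1 ∈ φ.target
  · have hz' : z ∈ (Prod.fst ⁻¹' φ.target : Set (X × X)) := hz
    rw [indicator_of_mem hz', h2 hz, indicator_of_mem hz, indicator_of_mem hz',
      Function.comp_apply, φ.invExt_of_mem hz]
  · have hz' : z ∉ (Prod.fst ⁻¹' φ.target : Set (X × X)) := hz
    rw [indicator_of_notMem hz', indicator_of_notMem hz, zero_mul]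

theorem isoOp_ofGroup_mul_mulOp (g : Γ) (f : Linfty μ) :
    mulOp Γ (g • f) * isoOp μ (LocalIso.ofGroup g) =
      isoOp μ (LocalIso.ofGroup g) * mulOp Γ f := by
  ext1 ξ
  apply Lp.ext
  rw [mul_apply_eq_comp, mul_apply_eq_comp]
  filter_upwards [coeFn_isoOp (LocalIso.ofGroup g) (mulOp Γ f ξ),
    (LocalIso.ofGroup g).ae_pull (coeFn_mulOp f ξ),
    coeFn_mulOp (g • f) (isoOp μ (LocalIso.ofGroup g) ξ), coeFn_isoOp (LocalIso.ofGroup g) ξ,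
    ae_orbitMeasure_fst (Γ := Γ) (Linfty.coeFn_group_smul g f)] with z h1 h2 h3 h4 h5
  have hz : z.1 ∈ (LocalIso.ofGroup (X := X) g).target := mem_univ _
  have hz' : z ∈ (Prod.fst ⁻¹' (LocalIso.ofGroup (X := X) g).target : Set (X × X)) := hz
  rw [h1, h3, h4, h5, indicator_of_mem hz', indicator_of_mem hz', h2 hz]
  rfl

variable (Γ μ) in
/-- The relation ring `R_ρ(X)`: all finite sums `∑ fᵢ φᵢ` with `fᵢ ∈ L^∞(X)` and `φᵢ` a local
isomorphism from `R_ρ`, a unital subalgebra of the bounded operators on `L²(R_ρ, m)`, inside the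
von Neumann algebra of the relation (the weak closure of `R_ρ(X)`). -/
def relationRing : Subalgebra ℂ (HilbertR Γ μ →L[ℂ] HilbertR Γ μ) where
  carrier := {T | ∃ (n : ℕ) (f : Fin n → Linfty μ) (φ : Fin n → LocalIso (orbitRelation Γ X)),
    T = ∑ i, mulOp Γ (f i) * isoOp μ (φ i)}
  add_mem' := by
    rintro _ _ ⟨n, f, φ, rfl⟩ ⟨k, f', φ', rfl⟩
    refine ⟨n + k, Fin.append f f', Fin.append φ φ', ?_⟩
    rw [Fin.sum_univ_add]
    simp
  mul_mem' := by
    rintro _ _ ⟨n, f, φ, rfl⟩ ⟨k, f', φ', rfl⟩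
    choose a ha using fun (i : Fin n) (j : Fin k) => exists_isoOp_mul_mulOp (φ i) (f' j)
    refine ⟨n * k, fun l => f (finProdFinEquiv.symm l).1 *
      a (finProdFinEquiv.symm l).1 (finProdFinEquiv.symm l).2,
      fun l => (φ (finProdFinEquiv.symm l).1).comp (φ' (finProdFinEquiv.symm l).2), ?_⟩
    rw [Finset.sum_mul_sum, ← Finset.sum_product', Finset.univ_product_univ,
      ← finProdFinEquiv.symm.sum_comp]
    refine Finset.sum_congr rfl fun l _ => ?_
    rw [mulOp_mul, isoOp_comp, mul_assoc, ← mul_assoc (isoOp μ _), ha]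
    simp only [mul_assoc]
  algebraMap_mem' c := ⟨1, fun _ => c • 1, fun _ => LocalIso.ofGroup 1, by
    simp [mulOp_smul, mulOp_one, isoOp_ofGroup_one, Algebra.algebraMap_eq_smul_one]⟩

variable (Γ) in
/-- The inclusion of `L^∞(X)` into the relation ring. -/
def coeffHom : Linfty μ →+* relationRing Γ μ where
  toFun f := ⟨mulOp Γ f, 1, fun _ => f, fun _ => LocalIso.ofGroup 1, by
    simp [isoOp_ofGroup_one]⟩
  map_one' := Subtype.ext mulOp_one
  map_mul' f g := Subtype.ext (mulOp_mul f g)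
  map_add' f g := Subtype.ext (mulOp_add f g)
  map_zero' := Subtype.ext (by
    have h := mulOp_add (Γ := Γ) (0 : Linfty μ) 0
    rw [add_zero] at h
    exact left_eq_add.mp h)

variable (μ) in
/-- The local isomorphisms implemented by group elements, inside the relation ring. -/
def groupHom : Γ →* relationRing Γ μ where
  toFun g := ⟨isoOp μ (LocalIso.ofGroup g), 1, fun _ => 1, fun _ => LocalIso.ofGroup g, by
    simp [mulOp_one]⟩
  map_one' := Subtype.ext isoOp_ofGroup_one
  map_mul' g h := Subtype.ext (isoOp_ofGroup_mul g h)

/-- The left `L^∞(X)`-module structure of the relation ring, by left multiplication. -/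
instance : Module (Linfty μ) (relationRing Γ μ) := Module.compHom _ (coeffHom Γ)

variable (Γ μ) in
/-- The algebraic crossed product `L^∞(X) ⋊_alg Γ`: finite formal sums `∑ f_g g` with the
multiplication determined by `g f = (g • f) g`. Its left `L^∞(X)`-module structure is the
left multiplication. -/
abbrev CrossedProduct : Type _ := SkewMonoidAlgebra (Linfty μ) Γ

variable (Γ μ) in
/-- The natural ring homomorphism `L^∞(X) ⋊_alg Γ → R_ρ(X)`, which sends `f` to `f` and a group
element to the local isomorphism that it implements. -/
def inclusionHom : CrossedProduct Γ μ →+* relationRing Γ μ :=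
  SkewMonoidAlgebra.liftNCRingHom (coeffHom Γ) (groupHom μ)
    (fun {f g} => Subtype.ext (isoOp_ofGroup_mul_mulOp g f))

variable (Γ μ) in
/-- The same map, as a map of left `L^∞(X)`-modules. -/
def inclusion : CrossedProduct Γ μ →ₗ[Linfty μ] relationRing Γ μ where
  toFun := inclusionHom Γ μ
  map_add' := map_add _
  map_smul' f ξ := by
    induction ξ using SkewMonoidAlgebra.induction_on with
    | zero => simp
    | single g a =>
      rw [SkewMonoidAlgebra.smul_single]
      change inclusionHom Γ μ _ = coeffHom Γ f * inclusionHom Γ μ _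
      simp [inclusionHom, SkewMonoidAlgebra.liftNCRingHom, mul_assoc]
    | add a b ha hb => rw [smul_add, map_add, map_add, ha, hb, smul_add]

end RelationRing

end

end RankCompletion

/-!
# Rank completion of the crossed product and of the relation ring

Two facts about `ι : L^∞(X) ⋊_alg Γ → R_ρ(X)` give the theorem.

*It is injective* (`inclusion_injective`). The characteristic function of the diagonal is a vector of
`L²(R_ρ, m)`, and `∑ f_g g` sends it to the function `(x, y) ↦ ∑ f_g(x) 1[g⁻¹ x = y]`. Because the
action is essentially free, the graphs of distinct group elements are disjoint up to null sets, so
the value at `(x, h⁻¹ x)` is `f_h(x)` and all coefficients are recovered.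

*Its range is dense for the rank metric* (`exists_rank_sub_inclusion_lt`). The range of a local
isomorphism `φ` splits into countably many measurable sets `T g` on which `φ` coincides with the
group element `g`. Since `μ` is finite, finitely many of these sets exhaust the range up to a set
`D` of small measure, and the difference of `φ` and `∑ 1_{T g} g` over finitely many `g` is `1_D φ`,
whose rank is at most `μ D`.

The rank of an element is determined by its annihilator among the `p^⊥ ⊗ q^⊥`, so an injective
bimodule map preserves ranks (`rank_map_eq_of_injective`). The completion of a rank-preserving map
with dense range is bijective, by the usual argument for metric completions.
-/

namespace RankCompletion

open MeasureTheory Set Filter Topology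
open scoped ENNReal TensorProduct

noncomputable section

/-! ### Completions of injective bimodule maps with dense range -/

section Completion

variable {X : Type*} [MeasurableSpace X] {μ : Measure X} [IsProbabilityMeasure μ]
variable {L : Type*} [AddCommGroup L] [Module (Enveloping μ) L]
variable {L' : Type*} [AddCommGroup L'] [Module (Enveloping μ) L']

/-- The rank of `ξ` depends only on the annihilator of `ξ`, which an injective map preserves. -/
theorem rank_map_eq_of_injective (φ : L →ₗ[Enveloping μ] L') (hφ : Function.Injective φ) (ξ : L) :
    rank μ (φ ξ) = rank μ ξ := by
  unfold rank rankSet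
  simp only [← map_smul, map_eq_zero_iff φ hφ]

theorem Completion.map_injective (φ : L →ₗ[Enveloping μ] L') (hφ : Function.Injective φ) :
    Function.Injective (Completion.map φ) := by
  rw [injective_iff_map_eq_zero]
  intro u hu
  induction u using Submodule.Quotient.induction_on with
  | _ u =>
    have hu' : cauchyMap φ u ∈ nullSeqs μ L' := (Submodule.Quotient.mk_eq_zero _).1 hu
    refine (Submodule.Quotient.mk_eq_zero _).2 fun ε hε => ?_
    obtain ⟨N, hN⟩ := hu' ε hε
    refine ⟨N, fun n hn => ?_⟩
    rw [← rank_map_eq_of_injective φ hφ]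
    exact hN n hn

theorem Completion.map_surjective (φ : L →ₗ[Enveloping μ] L') (hφ : Function.Injective φ)
    (hd : ∀ η : L', ∀ ε > 0, ∃ ξ : L, rank μ (η - φ ξ) < ε) :
    Function.Surjective (Completion.map φ) := by
  intro u
  induction u using Submodule.Quotient.induction_on with
  | _ u =>
    choose v hv using fun n : ℕ => hd (u.1 n) (1 / ((n : ℝ) + 1)) Nat.one_div_pos_of_nat
    have hsmall : ∀ ε > 0, ∃ N, ∀ n ≥ N, rank μ (u.1 n - φ (v n)) < ε := by
      intro ε hε
      obtain ⟨N, hN⟩ := exists_nat_one_div_lt hε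
      exact ⟨N, fun n hn => (hv n).trans ((Nat.one_div_le_one_div hn).trans_lt hN)⟩
    have hvc : v ∈ cauchySeqs μ L := by
      intro ε hε
      obtain ⟨N, hN⟩ := hsmall (ε / 3) (by positivity)
      obtain ⟨K, hK⟩ := u.2 (ε / 3) (by positivity)
      refine ⟨max N K, fun m hm n hn => ?_⟩
      rw [← rank_map_eq_of_injective φ hφ, map_sub]
      have h1 := hN m (le_of_max_le_left hm)
      have h2 := hN n (le_of_max_le_left hn)
      have h3 := hK m (le_of_max_le_right hm) n (le_of_max_le_right hn)
      have h4 : φ (v m) - φ (v n) =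
          -(u.1 m - φ (v m)) + ((u.1 m - u.1 n) + (u.1 n - φ (v n))) := by abel
      have h5 := rank_add_le (μ := μ) (-(u.1 m - φ (v m)))
        ((u.1 m - u.1 n) + (u.1 n - φ (v n)))
      have h6 := rank_add_le (μ := μ) (u.1 m - u.1 n) (u.1 n - φ (v n))
      rw [rank_neg] at h5
      rw [h4]
      linarith
    refine ⟨Submodule.Quotient.mk ⟨v, hvc⟩, ?_⟩
    refine (Submodule.Quotient.eq _).2 fun ε hε => ?_
    obtain ⟨N, hN⟩ := hsmall ε hε
    refine ⟨N, fun n hn => ?_⟩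
    change rank μ (φ (v n) - u.1 n) < ε
    rw [← neg_sub, rank_neg]
    exact hN n hn

end Completion

/-! ### Characteristic functions and the rank of diagonal bimodules -/

section CharFn

variable {X : Type*} [MeasurableSpace X] {μ : Measure X} [IsProbabilityMeasure μ]

variable (μ) in
/-- The characteristic function of a measurable set, as an element of `L^∞(X, μ)`. -/
def charFn {s : Set X} (hs : MeasurableSet s) : Linfty μ :=
  indicatorConstLp ∞ hs (measure_ne_top μ s) 1

theorem coeFn_charFn {s : Set X} (hs : MeasurableSet s) :
    ⇑(charFn μ hs) =ᵐ[μ] s.indicator fun _ => 1 :=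
  indicatorConstLp_coeFn

theorem isStarProjection_charFn {s : Set X} (hs : MeasurableSet s) :
    IsStarProjection (charFn μ hs) := by
  refine ⟨?_, ?_⟩
  · apply Lp.ext
    filter_upwards [Linfty.coeFn_mul (charFn μ hs) (charFn μ hs), coeFn_charFn (μ := μ) hs]
      with x h1 h2
    by_cases hx : x ∈ s <;> simp [h1, h2, hx]
  · apply Lp.ext
    filter_upwards [Lp.coeFn_star (charFn μ hs), coeFn_charFn (μ := μ) hs] with x h1 h2
    by_cases hx : x ∈ s <;> simp [h1, h2, hx]

theorem trace_charFn {s : Set X} (hs : MeasurableSet s) : trace (charFn μ hs) = μ.real s := by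
  unfold trace
  rw [integral_congr_ae (coeFn_charFn hs), integral_indicator_const _ hs]
  simp

theorem charFn_biUnion {ι : Type*} {T : ι → Set X} (hT : ∀ i, MeasurableSet (T i))
    (hd : Pairwise (Function.onFun Disjoint T)) (F : Finset ι) :
    charFn μ (F.measurableSet_biUnion fun i _ => hT i) = ∑ i ∈ F, charFn μ (hT i) := by
  classical
  induction F using Finset.induction_on with
  | empty => simp [charFn]
  | insert a F ha ih =>
    rw [Finset.sum_insert ha, ← ih]
    have h := indicatorConstLp_disjoint_union (p := ∞) (hT a)
      (F.measurableSet_biUnion fun i _ => hT i) (measure_ne_top μ _) (measure_ne_top μ _)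
      (disjoint_iUnion₂_right.2 fun i hi => hd fun h => ha (h ▸ hi)) (1 : ℂ)
    simp only [charFn, ← h, Finset.set_biUnion_insert]

theorem charFn_diff_add {s t : Set X} (hs : MeasurableSet s) (ht : MeasurableSet t) (hts : t ⊆ s) :
    charFn μ (hs.diff ht) + charFn μ ht = charFn μ hs := by
  have h := indicatorConstLp_disjoint_union (p := ∞) (hs.diff ht) ht (measure_ne_top μ _)
    (measure_ne_top μ _) disjoint_sdiff_left (1 : ℂ)
  simp only [charFn, ← h, sdiff_union_of_subset hts]

theorem lr_smul_diag {L : Type*} [AddCommGroup L] [Module (Linfty μ) L] (a b : Linfty μ)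
    (ξ : Diag L) : lr a b • ξ = (show Diag L from (a * b) • (show L from ξ)) := by
  have h : envelopingMul μ (lr a b) = a * b :=
    Algebra.TensorProduct.lift_tmul _ _ _ a (MulOpposite.op b)
  change envelopingMul μ (lr a b) • (show L from ξ) = _
  rw [h]

/-- An element of a module that is supported on a set `s` has rank at most `μ s` for the diagonal
bimodule structure. -/
theorem rank_diag_charFn_smul_le {L : Type*} [AddCommGroup L] [Module (Linfty μ) L]
    {s : Set X} (hs : MeasurableSet s) (ξ : L) :
    rank μ (show Diag L from charFn μ hs • ξ) ≤ μ.real s := by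
  have hp := isStarProjection_charFn (μ := μ) hs
  refine rank_le ⟨charFn μ hs, 0, hp, isStarProjection_zero, ?_, ?_⟩
  · rw [lr_smul_diag]
    change ((1 - charFn μ hs) * (1 - 0)) • charFn μ hs • ξ = 0
    rw [smul_smul, sub_zero, mul_one, sub_mul, one_mul, hp.isIdempotentElem.eq, sub_self, zero_smul]
  · rw [trace_charFn, trace_zero, add_zero]

theorem rank_diag_smul_le {L : Type*} [AddCommGroup L] [Module (Linfty μ) L]
    (f : Linfty μ) (ξ : L) :
    rank μ (show Diag L from f • ξ) ≤ rank μ (show Diag L from ξ) := by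
  have h := rank_map_le (μ := μ) (Diag.map (LinearMap.lsmul (Linfty μ) L f)) ξ
  exact h

end CharFn

/-! ### Injectivity of the inclusion of the crossed product -/

section Relation

variable {Γ X : Type*} [Group Γ] [MulAction Γ X] [MeasurableSpace X]
  [StandardBorelSpace X] [Countable Γ] [MeasurableConstSMul Γ X] {μ : Measure X}

/-- A property that holds almost everywhere on the orbit relation holds almost everywhere on the
graph of each group element. -/
theorem ae_graph_of_ae_orbitMeasure (g : Γ) {P : X × X → Prop}
    (h : ∀ᵐ z ∂(orbitMeasure Γ μ), P z) : ∀ᵐ x ∂μ, P (x, g • x) := by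
  obtain ⟨N, hN, hNm, hN0⟩ := exists_measurable_superset_of_null (ae_iff.1 h)
  rw [orbitMeasure_apply hNm, lintegral_eq_zero_iff (measurable_count_section hNm)] at hN0
  filter_upwards [hN0] with x hx
  by_contra hP
  have hx' := Measure.count_eq_zero_iff.1 hx
  have hmem : g • x ∈ {y | (x, y) ∈ N ∩ orbitRelation Γ X} :=
    ⟨hN hP, mk_smul_mem_orbitRelation g x⟩
  rw [hx'] at hmem
  exact hmem

variable (Γ μ) in
/-- The diagonal has finite measure, so its characteristic function lies in `L²(R_ρ, m)`. -/
theorem orbitMeasure_diagonal_ne_top [IsFiniteMeasure μ] :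
    orbitMeasure Γ μ (diagonal X) ≠ ∞ := by
  have : orbitMeasure Γ μ (diagonal X) ≤ μ univ := by
    rw [orbitMeasure_apply measurableSet_diagonal, ← lintegral_one]
    refine lintegral_mono fun x => ?_
    have hs : {y | (x, y) ∈ diagonal X ∩ orbitRelation Γ X} ⊆ {x} := fun y hy => hy.1.symm
    exact (measure_mono hs).trans (by simp)
  exact (this.trans_lt (measure_lt_top μ _)).ne

variable (Γ μ) in
/-- The characteristic function of the diagonal, which is a
separating vector for the crossed product when the action is essentially free. -/
def diagVector [IsFiniteMeasure μ] : HilbertR Γ μ :=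
  indicatorConstLp 2 measurableSet_diagonal (orbitMeasure_diagonal_ne_top Γ μ) 1

variable [IsProbabilityMeasure μ] [SMulInvariantMeasure Γ X μ]

theorem inclusion_single (g : Γ) (f : Linfty μ) :
    inclusion Γ μ (SkewMonoidAlgebra.single g f) = f • groupHom μ g := by
  change inclusionHom Γ μ _ = coeffHom Γ f * groupHom μ g
  simp [inclusionHom, SkewMonoidAlgebra.liftNCRingHom]

/-- The coefficients of an element `ξ` of the crossed product can be read off from the value of the
operator `ι(ξ)` at the characteristic function of the diagonal. This is where freeness enters: the
graphs of distinct group elements are essentially disjoint. -/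
theorem inclusion_diagVector_ae (hfree : ∀ g : Γ, g ≠ 1 → ∀ᵐ x ∂μ, g • x ≠ x)
    (ξ : CrossedProduct Γ μ) (h : Γ) :
    ∀ᵐ x ∂μ, (inclusion Γ μ ξ).1 (diagVector Γ μ) (x, h⁻¹ • x) = ξ.coeff h x := by
  induction ξ using SkewMonoidAlgebra.induction_on with
  | zero =>
    rw [map_zero]
    filter_upwards [ae_graph_of_ae_orbitMeasure h⁻¹ (Lp.coeFn_zero ℂ 2 (orbitMeasure Γ μ)),
      Lp.coeFn_zero ℂ ∞ μ] with x h1 h2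
    exact h1.trans h2.symm
  | add a b ha hb =>
    rw [map_add]
    filter_upwards [ha, hb, ae_graph_of_ae_orbitMeasure h⁻¹
      (Lp.coeFn_add ((inclusion Γ μ a).1 (diagVector Γ μ)) ((inclusion Γ μ b).1 (diagVector Γ μ))),
      Lp.coeFn_add (a.coeff h) (b.coeff h)] with x h1 h2 h3 h4
    refine h3.trans ?_
    rw [SkewMonoidAlgebra.coeff_add, Finsupp.add_apply, h4, Pi.add_apply, Pi.add_apply, h1, h2]
  | single g f =>
    rw [inclusion_single]
    have hval : ∀ᵐ z ∂(orbitMeasure Γ μ), (f • groupHom μ g).1 (diagVector Γ μ) z =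
        f z.1 * (diagonal X).indicator (fun _ => (1 : ℂ)) (g⁻¹ • z.1, z.2) := by
      filter_upwards [coeFn_mulOp f (isoOp μ (LocalIso.ofGroup g) (diagVector Γ μ)),
        coeFn_isoOp (LocalIso.ofGroup g) (diagVector Γ μ),
        (LocalIso.ofGroup (X := X) g).ae_pull (indicatorConstLp_coeFn (p := 2)
          (hs := measurableSet_diagonal) (hμs := orbitMeasure_diagonal_ne_top Γ μ) (c := (1 : ℂ)))]
        with z h1 h2 h3
      refine h1.trans ?_
      rw [h2, indicator_of_mem (s := Prod.fst ⁻¹' (LocalIso.ofGroup (X := X) g).target)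
        (mem_univ _)]
      exact congrArg _ (h3 (mem_univ _))
    have hf : ∀ᵐ x ∂μ, g ≠ h → g⁻¹ • x ≠ h⁻¹ • x := by
      by_cases hgh : g = h
      · simp [hgh]
      · filter_upwards [hfree (h * g⁻¹) fun he => hgh (mul_inv_eq_one.1 he).symm] with x hx _ he
        exact hx (by rw [mul_smul, he, smul_inv_smul])
    filter_upwards [ae_graph_of_ae_orbitMeasure h⁻¹ hval, hf, Lp.coeFn_zero ℂ ∞ μ] with x h1 h2 h3
    rw [h1, SkewMonoidAlgebra.coeff_single]
    by_cases hgh : g = h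
    · subst hgh
      simp
    · rw [Finsupp.single_eq_of_ne (Ne.symm hgh), h3,
        indicator_of_notMem (by simpa using h2 hgh)]
      simp

theorem inclusion_injective (hfree : ∀ g : Γ, g ≠ 1 → ∀ᵐ x ∂μ, g • x ≠ x) :
    Function.Injective (inclusion Γ μ) := by
  rw [injective_iff_map_eq_zero]
  intro ξ hξ
  refine SkewMonoidAlgebra.ext fun h => Lp.ext ?_
  have h0 := inclusion_diagVector_ae hfree 0 h
  have h1 := inclusion_diagVector_ae hfree ξ h
  rw [hξ] at h1
  rw [map_zero] at h0
  filter_upwards [h0, h1] with x h0 h1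
  exact h1.symm.trans h0

/-! ### Density of the crossed product in the relation ring -/

/-- The range of a local isomorphism is partitioned into measurable sets `T g` on which it is
implemented by `g`. -/
theorem LocalIso.exists_partition (φ : LocalIso (orbitRelation Γ X)) :
    ∃ T : Γ → Set X, (∀ g, MeasurableSet (T g)) ∧ Pairwise (Function.onFun Disjoint T) ∧
      ⋃ g, T g = φ.target ∧ ∀ g, ∀ x ∈ T g, φ.invFun x = g⁻¹ • x := by
  obtain ⟨e, he⟩ := exists_injective_nat Γ
  -- `T g` is the set where `g` is the first element implementing `φ`, in the enumeration `e`.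
  refine ⟨fun g => (φ.target ∩ {x | φ.invExt x = g⁻¹ • x}) ∩
    ⋂ k : Γ, {x | e k < e g → φ.invExt x ≠ k⁻¹ • x}, fun g => ?_, ?_, ?_, ?_⟩
  · refine (φ.measurableSet_target.inter
      (measurableSet_eq_fun φ.measurable_invExt (measurable_const_smul g⁻¹))).inter
      (MeasurableSet.iInter fun k => ?_)
    by_cases hk : e k < e g
    · simp only [hk, true_imp_iff]
      exact (measurableSet_eq_fun φ.measurable_invExt (measurable_const_smul k⁻¹)).compl
    · simp [hk]
  · intro g k hgk
    rw [Function.onFun, Set.disjoint_left]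
    intro x hg hk
    rcases lt_trichotomy (e g) (e k) with h | h | h
    · exact mem_iInter.1 hk.2 g h hg.1.2
    · exact hgk (he h)
    · exact mem_iInter.1 hg.2 k h hk.1.2
  · refine Subset.antisymm (iUnion_subset fun g x hx => hx.1.1) fun x hx => ?_
    obtain ⟨g, hg, hmin⟩ := exists_first (P := fun g : Γ => φ.invExt x = g⁻¹ • x) e (by
      obtain ⟨g, hg⟩ := (φ.invExt_orbit hx (φ.invExt x)).1 ⟨1, (one_smul _ _).symm⟩
      exact ⟨g⁻¹, by rw [inv_inv]; exact hg⟩)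
    exact mem_iUnion.2 ⟨g, ⟨hx, hg⟩, mem_iInter.2 fun k hk => hmin k hk⟩
  · intro g x hx
    rw [← φ.invExt_of_mem hx.1.1]
    exact hx.1.2

variable (μ) in
/-- A local isomorphism, as an element of the relation ring. -/
def isoElem (φ : LocalIso (orbitRelation Γ X)) : relationRing Γ μ :=
  ⟨isoOp μ φ, 1, fun _ => 1, fun _ => φ, by simp [mulOp_one]⟩

/-- Local isomorphisms whose inverses agree on `s` have the same restriction to `s`. -/
theorem charFn_smul_isoElem_congr {φ ψ : LocalIso (orbitRelation Γ X)} {s : Set X}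
    (hs : MeasurableSet s) (hφ : s ⊆ φ.target) (hψ : s ⊆ ψ.target)
    (h : ∀ x ∈ s, φ.invFun x = ψ.invFun x) :
    charFn μ hs • isoElem μ φ = charFn μ hs • isoElem μ ψ := by
  refine Subtype.ext (ContinuousLinearMap.ext fun ξ => Lp.ext ?_)
  change mulOp Γ (charFn μ hs) (isoOp μ φ ξ) =ᵐ[_] mulOp Γ (charFn μ hs) (isoOp μ ψ ξ)
  filter_upwards [coeFn_mulOp (charFn μ hs) (isoOp μ φ ξ), coeFn_isoOp φ ξ,
    coeFn_mulOp (charFn μ hs) (isoOp μ ψ ξ), coeFn_isoOp ψ ξ,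
    ae_orbitMeasure_fst (Γ := Γ) (coeFn_charFn (μ := μ) hs)] with z h1 h2 h3 h4 h5
  rw [h1, h2, h3, h4, h5]
  by_cases hz : z.1 ∈ s
  · rw [indicator_of_mem (s := Prod.fst ⁻¹' φ.target) (hφ hz),
      indicator_of_mem (s := Prod.fst ⁻¹' ψ.target) (hψ hz), h _ hz]
  · rw [indicator_of_notMem hz, zero_mul, zero_mul]

theorem charFn_target_smul_isoElem (φ : LocalIso (orbitRelation Γ X)) :
    charFn μ φ.measurableSet_target • isoElem μ φ = isoElem μ φ := by
  refine Subtype.ext (ContinuousLinearMap.ext fun ξ => Lp.ext ?_)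
  change mulOp Γ (charFn μ φ.measurableSet_target) (isoOp μ φ ξ) =ᵐ[_] isoOp μ φ ξ
  filter_upwards [coeFn_mulOp (charFn μ φ.measurableSet_target) (isoOp μ φ ξ), coeFn_isoOp φ ξ,
    ae_orbitMeasure_fst (Γ := Γ) (coeFn_charFn (μ := μ) φ.measurableSet_target)] with z h1 h2 h3
  rw [h1, h2, h3]
  by_cases hz : z.1 ∈ φ.target
  · rw [indicator_of_mem hz, one_mul]
  · rw [indicator_of_notMem hz, zero_mul, indicator_of_notMem (s := Prod.fst ⁻¹' φ.target) hz]

/-- All but an arbitrarily small part of a local isomorphism is implemented by finitely many group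
elements. -/
theorem exists_rank_isoElem_sub_lt (φ : LocalIso (orbitRelation Γ X)) {ε : ℝ} (hε : 0 < ε) :
    ∃ ξ : CrossedProduct Γ μ,
      rank μ (show Diag (relationRing Γ μ) from isoElem μ φ - inclusion Γ μ ξ) < ε := by
  obtain ⟨T, hT, hd, hU, hinv⟩ := φ.exists_partition
  have hTt : ∀ g, T g ⊆ φ.target := fun g => hU ▸ subset_iUnion T g
  have hFm : ∀ F : Finset Γ, MeasurableSet (⋃ g ∈ F, T g) := fun F =>
    F.measurableSet_biUnion fun g _ => hT g
  have hlim : Tendsto (fun F : Finset Γ => μ (φ.target \ ⋃ g ∈ F, T g)) atTop (𝓝 0) := by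
    have h := tendsto_measure_iInter_atTop (μ := μ)
      (s := fun F : Finset Γ => φ.target \ ⋃ g ∈ F, T g)
      (fun F => (φ.measurableSet_target.diff (hFm F)).nullMeasurableSet)
      (fun F F' hF => sdiff_subset_sdiff_right (biUnion_subset_biUnion_left hF))
      ⟨∅, measure_ne_top μ _⟩
    have h0 : ⋂ F : Finset Γ, (φ.target \ ⋃ g ∈ F, T g) = ∅ := by
      refine eq_empty_of_forall_notMem fun x hx => ?_
      have hxt : x ∈ φ.target := (mem_iInter.1 hx ∅).1
      rw [← hU] at hxt
      obtain ⟨g, hg⟩ := mem_iUnion.1 hxt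
      exact (mem_iInter.1 hx {g}).2 (by simpa using hg)
    rw [h0, measure_empty] at h
    exact h
  obtain ⟨F, hF⟩ := (hlim.eventually_lt_const (ENNReal.ofReal_pos.2 hε)).exists
  refine ⟨∑ g ∈ F, SkewMonoidAlgebra.single g (charFn μ (hT g)), ?_⟩
  have hsum : inclusion Γ μ (∑ g ∈ F, SkewMonoidAlgebra.single g (charFn μ (hT g))) =
      charFn μ (hFm F) • isoElem μ φ := by
    rw [map_sum, charFn_biUnion hT hd F, Finset.sum_smul]
    refine Finset.sum_congr rfl fun g _ => ?_
    rw [inclusion_single]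
    exact (charFn_smul_isoElem_congr (ψ := LocalIso.ofGroup g) (hT g) (hTt g) (subset_univ _)
      (hinv g)).symm
  have hdiff : isoElem μ φ - inclusion Γ μ (∑ g ∈ F, SkewMonoidAlgebra.single g (charFn μ (hT g))) =
      charFn μ (φ.measurableSet_target.diff (hFm F)) • isoElem μ φ := by
    rw [hsum, sub_eq_iff_eq_add, ← add_smul,
      charFn_diff_add φ.measurableSet_target (hFm F) (iUnion₂_subset fun g _ => hTt g),
      charFn_target_smul_isoElem]
  rw [hdiff]
  exact (rank_diag_charFn_smul_le _ _).trans_lt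
    ((ENNReal.lt_ofReal_iff_toReal_lt (measure_ne_top μ _)).1 hF)

/-- The crossed product is dense in the relation ring for the rank metric. -/
theorem exists_rank_sub_inclusion_lt (η : relationRing Γ μ) {ε : ℝ} (hε : 0 < ε) :
    ∃ ξ : CrossedProduct Γ μ,
      rank μ (show Diag (relationRing Γ μ) from η - inclusion Γ μ ξ) < ε := by
  obtain ⟨n, f, φ, hη⟩ := η.2
  have hη' : η = ∑ i, f i • isoElem μ (φ i) := by
    apply Subtype.ext
    rw [hη, AddSubmonoidClass.coe_finsetSum]
    rfl
  rw [hη']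
  clear hη' hη
  refine Finset.sum_induction (fun i => f i • isoElem μ (φ i))
    (fun η => ∀ ε > 0, ∃ ξ : CrossedProduct Γ μ,
      rank μ (show Diag (relationRing Γ μ) from η - inclusion Γ μ ξ) < ε) ?_ ?_ ?_ ε hε
  · intro η η' h h' ε hε
    obtain ⟨ξ, hξ⟩ := h (ε / 2) (half_pos hε)
    obtain ⟨ξ', hξ'⟩ := h' (ε / 2) (half_pos hε)
    refine ⟨ξ + ξ', ?_⟩
    rw [map_add, add_sub_add_comm]
    refine (rank_add_le (L := Diag (relationRing Γ μ)) _ _).trans_lt ?_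
    linarith
  · intro ε hε
    refine ⟨0, ?_⟩
    rw [map_zero, sub_zero]
    exact (rank_zero (L := Diag (relationRing Γ μ))).trans_lt hε
  · intro i _ ε hε
    obtain ⟨ξ, hξ⟩ := exists_rank_isoElem_sub_lt (μ := μ) (φ i) hε
    refine ⟨f i • ξ, ?_⟩
    rw [map_smul, ← smul_sub]
    exact (rank_diag_smul_le _ _).trans_lt hξ

theorem completion_map_inclusion_bijective
    (hinj : Function.Injective (inclusion Γ μ)) :
    Function.Bijective (Completion.map (Diag.map (inclusion Γ μ))) := by
  have hinj' : Function.Injective (Diag.map (inclusion Γ μ)) := hinj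
  refine ⟨Completion.map_injective _ hinj', Completion.map_surjective _ hinj' ?_⟩
  intro η ε hε
  obtain ⟨ξ, hξ⟩ := exists_rank_sub_inclusion_lt (Γ := Γ) (μ := μ) η hε
  exact ⟨ξ, hξ⟩

end Relation

end

end RankCompletion

/-- For an essentially free, measure preserving action of a countable group `Γ` on a standard
probability space, the natural map `ι : L^∞(X) ⋊_alg Γ → R_ρ(X)` is injective, and the map `c(ι)`
that it induces on rank completions is an isomorphism of `L^∞(X)`-bimodules, where both sides carry
the bimodule structure given by the diagonal left action. -/
theorem mainTheorem8 {Γ X : Type*} [Group Γ] [Countable Γ] [MeasurableSpace X]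
    [StandardBorelSpace X] [MulAction Γ X] [MeasurableConstSMul Γ X]
    (μ : MeasureTheory.Measure X) [MeasureTheory.IsProbabilityMeasure μ]
    [MeasureTheory.SMulInvariantMeasure Γ X μ]
    (hfree : ∀ g : Γ, g ≠ 1 → ∀ᵐ x ∂μ, g • x ≠ x) :
    Function.Injective (RankCompletion.inclusion Γ μ) ∧
      ∃ e : RankCompletion.Completion μ
            (RankCompletion.Diag (RankCompletion.CrossedProduct Γ μ))
          ≃ₗ[RankCompletion.Enveloping μ]
          RankCompletion.Completion μ
            (RankCompletion.Diag (RankCompletion.relationRing Γ μ)),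
        e.toLinearMap =
          RankCompletion.Completion.map (RankCompletion.Diag.map (RankCompletion.inclusion Γ μ)) :=
  by
  have hinj := RankCompletion.inclusion_injective (μ := μ) hfree
  exact ⟨hinj, LinearEquiv.ofBijective _
    (RankCompletion.completion_map_inclusion_bijective hinj), LinearMap.ext fun _ => rfl⟩
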